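/- **Theorem 3.2 (Convergence rate).** Let $\Theta\subseteq\mathbb R^m$ be open and let $f:\mathbb R^n\times\Theta\to\mathbb R$ satisfy: * $f$ is of class $C^2$ jointly in $(x,\theta)$; * there is $L>0$ with $\|\nabla_xf(x_1,\theta_1)-\nabla_xf(x_2,\theta_2)\|\le L\sqrt{\|x_1-x_2\|^2+\|\theta_1-\theta_2\|^2}$ for all $x_1,x_2\in\mathbb R^n$, $\theta_1,\theta_2\in\Theta$; * for every $\theta\in\Theta$ all sublevel sets of $f(\cdot,\theta)$ are bounded, and $f(\cdot,\theta)$ is strongly convex (with a modulus that may depend on $\theta$). Let $x^\star(\theta)$ denote the unique minimizer of $f(\cdot,\theta)$ and $X^\star(\theta)=(x^\star(\theta),x^\star(\theta))\in\mathbb R^{2n}$. Let $a_k,b_k\in[0,1]$ and $\gamma_k\in(0,2/L)$ for $k\in\mathbb N$, and suppose that there is $\tau>0$ such that for every $k\ge1$ one of the following holds: * $a_k<\frac{\gamma_kL}{2}b_k$ and $\tau<(1+a_k)-\frac{\gamma_kL}{2}(1+b_k)^2$; * ($b_k\le a_k$ or $\frac{\gamma_kL}{2}b_k\le a_k<b_k$)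 and $\tau<(1-3a_k)-\frac{\gamma_kL}{2}(1-b_k)^2$. Suppose moreover that $a_k\to a\in[0,1]$, $b_k\to b\in[0,1]$, $\gamma_k\to\gamma\in(0,2/L)$ and that, if $a,b<1$, then for every $\theta\in\Theta$ every eigenvalue $\eta$ of $G_\theta=\mathrm{Id}-\gamma\nabla_x^2f(x^\star(\theta),\theta)$ satisfies $$\frac{2(b-a)-1}{1+2b}<\eta .$$ Let $X_0:\Theta\to\mathbb R^n\times\mathbb R^n=\mathbb R^{2n}$ be continuously differentiable and define, for $k\ge0$ and $\theta\in\Theta$, $X_{k+1}(\theta)=F_k(X_k(\theta),\theta)$, where $$F_k(x,z,\theta)=\bigl(x+a_k(x-z)-\gamma_k\nabla_xf(x+b_k(x-z),\theta),\;x\bigr).$$ For $\theta\in\Theta$ let $$M=\begin{pmatrix}(1+a)\mathrm{Id}-\gamma(1+b)\nabla_x^2f(x^\star(\theta),\theta)&-a\,\mathrm{Id}+\gamma b\nabla_x^2f(x^\star(\theta),\theta)\\ \mathrm{Id}&0\end{pmatrix}$$ and let $\rho(M)$ be its spectral radius (the largest modulus of its complex eigenvalues). Then for every $\theta\in\Theta$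 the minimizer $x^\star(\theta)$ exists and is unique, $X^\star$ and all $X_k$ are differentiable at $\theta$, and for every $\varepsilon>0$ there is a $K$ such that for all $k\ge K$ $$\|\partial_\theta X_{k+1}(\theta)-\partial_\theta X^\star(\theta)\|\le 2\rho(M)\,\|\partial_\theta X_k(\theta)-\partial_\theta X^\star(\theta)\|+\varepsilon\bigl(2+\|\partial_\theta X_k(\theta)-\partial_\theta X^\star(\theta)\|\bigr),$$ where $\|\cdot\|$ is the operator norm of matrices with respect to the Euclidean norms. -/

import Mathlib

namespace InertialDiff

/-- The Euclidean space `ℝⁿ`. -/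
abbrev Eucl (n : ℕ) : Type := EuclideanSpace ℝ (Fin n)

/-- The doubled space `ℝⁿ × ℝⁿ = ℝ²ⁿ` with its Euclidean norm; its elements are `X = (x, z)`. -/
abbrev State (n : ℕ) : Type := WithLp 2 (Eucl n × Eucl n)

noncomputable section

variable {n m : ℕ}

/-- The partial gradient `∇ₓ f(x, θ)`. -/
def gradX (f : Eucl n → Eucl m → ℝ) (x : Eucl n) (θ : Eucl m) : Eucl n :=
  gradient (fun y => f y θ) x

/-- The Hessian matrix `∇ₓ² f(x, θ)`, i.e. the Jacobian matrix at `x` of `∇ₓ f(·, θ)`. -/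
def hessX (f : Eucl n → Eucl m → ℝ) (x : Eucl n) (θ : Eucl m) : Matrix (Fin n) (Fin n) ℝ :=
  Matrix.of fun i j => (fderiv ℝ (fun y => gradX f y θ) x (EuclideanSpace.single j 1)) i

/-- One inertial step on the doubled space, with inertial parameters `a`, `b` and step size `γ`:
`(x, z) ↦ (y_a - γ ∇ₓ f(y_b, θ), x)`, where `y_s = x + s (x - z)`. -/
def inertialMap (f : Eucl n → Eucl m → ℝ) (a b γ : ℝ) (X : State n) (θ : Eucl m) : State n :=
  WithLp.toLp 2
    (X.fst + a • (X.fst - X.snd) - γ • gradX f (X.fst + b • (X.fst - X.snd)) θ, X.fst)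

/-- The iterates `X_{k+1}(θ) = F_k(X_k(θ), θ)` started at the given function `X₀`, as functions
of the parameter `θ`. -/
def iterate (f : Eucl n → Eucl m → ℝ) (a b γ : ℕ → ℝ) (X₀ : Eucl m → State n) :
    ℕ → Eucl m → State n
  | 0 => X₀
  | k + 1 => fun θ => inertialMap f (a k) (b k) (γ k) (iterate f a b γ X₀ k θ) θ

/-- `x` is a global minimizer of `f(·, θ)`. -/
def IsMinimizer (f : Eucl n → Eucl m → ℝ) (θ : Eucl m) (x : Eucl n) : Prop :=
  ∀ y, f x θ ≤ f y θ

/-- The minimizer `x⋆(θ)` of `f(·, θ)` (an arbitrary point when there is none). -/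
def xStar (f : Eucl n → Eucl m → ℝ) (θ : Eucl m) : Eucl n :=
  Classical.epsilon (IsMinimizer f θ)

/-- `X⋆(θ) = (x⋆(θ), x⋆(θ))`. -/
def XStar (f : Eucl n → Eucl m → ℝ) (θ : Eucl m) : State n :=
  WithLp.toLp 2 (xStar f θ, xStar f θ)

/-- `G_θ = Id - γ ∇ₓ² f(x⋆(θ), θ)`. -/
def matG (f : Eucl n → Eucl m → ℝ) (γ : ℝ) (θ : Eucl m) : Matrix (Fin n) (Fin n) ℝ :=
  1 - γ • hessX f (xStar f θ) θ

/-- The `2n × 2n` block matrix `M`, evaluated at `(x⋆(θ), θ)`. -/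
def matM (f : Eucl n → Eucl m → ℝ) (a b γ : ℝ) (θ : Eucl m) :
    Matrix (Fin n ⊕ Fin n) (Fin n ⊕ Fin n) ℝ :=
  Matrix.fromBlocks
    ((1 + a) • (1 : Matrix (Fin n) (Fin n) ℝ) - (γ * (1 + b)) • hessX f (xStar f θ) θ)
    (-(a • (1 : Matrix (Fin n) (Fin n) ℝ)) + (γ * b) • hessX f (xStar f θ) θ)
    1
    0

/-- The spectral radius of a real square matrix: the largest modulus of its complex eigenvalues
(the supremum is finite, since a matrix has finitely many eigenvalues). -/
def specRadius {ι : Type} [Fintype ι] [DecidableEq ι] (A : Matrix ι ι ℝ) : ℝ :=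
  (spectralRadius ℂ (A.map (fun r : ℝ => (r : ℂ)))).toReal

end

end InertialDiff

/-! The estimate follows from a stronger fact: the derivative errors `∂X_k(θ) - ∂X⋆(θ)` tend to
zero. Their norms are eventually below `2 * ε`, and the right-hand side is never smaller than that,
because `ρ(M) ≥ 0`.

Convergence comes from one Lyapunov argument, `inertial_tendsto_zero`, for the perturbed recursion
`u_{k+2} = u_{k+1} + a_k (u_{k+1} - u_k) - γ_k g_k + e_k` with `e_k → 0`. Here `g_k` is cocoercive
and strongly monotone relative to the extrapolated point. With `c = γL/2`, both parameter regimes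
reduce in the limit to the single strict inequality `2|a - cb| + a + cb² + c < 1`, which is what
makes the energy contract.

The argument is used twice. For the iterates, `u_k = x_k - x⋆` and `e_k = 0`; strong convexity and
the Baillon–Haddad inequality supply the two bounds on the gradient. For the derivatives in a
direction `v`, `u_k = ∂x_k v - ∂x⋆ v` and `g_k` is the Hessian at the extrapolated point applied to
the extrapolated error; the two bounds pass to the Hessian through difference quotients. The forcing
term then vanishes in the limit, because the extrapolated points converge to `x⋆` and the
stationarity equation `∇ₓf(x⋆(θ), θ) = 0` can be differentiated. -/

section InertialIteration

open Filter Topology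

/-- No lower bound on `u` is required, so one-sided estimates suffice and positivity of the energy
need not be checked. -/
theorem eventually_le_of_contraction {u δ : ℕ → ℝ} {r : ℝ} (hr0 : 0 ≤ r) (hr1 : r < 1)
    (hδ : Tendsto δ atTop (𝓝 0)) (h : ∀ᶠ k in atTop, u (k + 1) ≤ r * u k + δ k)
    {ε : ℝ} (hε : 0 < ε) : ∀ᶠ k in atTop, u k ≤ ε := by
  have h1 : ∀ᶠ k in atTop, δ k < (1 - r) * (ε / 2) :=
    hδ.eventually_lt_const (mul_pos (by linarith) (by linarith))
  obtain ⟨K, hK⟩ := eventually_atTop.1 (h.and h1)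
  -- The level `ε / 2` is the fixed point of `t ↦ r * t + (1 - r) * (ε / 2)`, so the excess over it
  -- shrinks geometrically.
  have h2 : ∀ j, u (K + j) - ε / 2 ≤ r ^ j * (u K - ε / 2) := by
    intro j
    induction j with
    | zero => simp
    | succ j ih =>
      obtain ⟨h3, h4⟩ := hK (K + j) (by omega)
      have := mul_le_mul_of_nonneg_left ih hr0
      rw [← add_assoc, pow_succ']
      nlinarith
  have h3 : Tendsto (fun j => r ^ j * (u K - ε / 2)) atTop (𝓝 0) := by
    simpa using (tendsto_pow_atTop_nhds_zero_of_lt_one hr0 hr1).mul_const (u K - ε / 2)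
  have h4 := h3.eventually_lt_const (half_pos hε)
  obtain ⟨J, hJ⟩ := eventually_atTop.1 h4
  refine eventually_atTop.2 ⟨K + J, fun k hk => ?_⟩
  obtain ⟨i, rfl⟩ := Nat.exists_eq_add_of_le hk
  have h5 := h2 (J + i)
  have h6 := hJ (J + i) (by omega)
  rw [← add_assoc] at h5
  linarith

/-! ### Lyapunov analysis of the perturbed inertial recursion -/

section Lyapunov

variable {E : Type*} [NormedAddCommGroup E] [InnerProductSpace ℝ E]

theorem two_mul_inner_le_sq (x y : E) {t : ℝ} (ht : 0 < t) :
    2 * inner ℝ x y ≤ t * ‖x‖ ^ 2 + ‖y‖ ^ 2 / t := by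
  have h1 : 0 ≤ ‖t • x - y‖ ^ 2 := by positivity
  rw [norm_sub_sq_real, inner_smul_left, norm_smul, Real.norm_of_nonneg ht.le] at h1
  simp only [conj_trivial] at h1
  rw [← sub_nonneg]
  have : t * ‖x‖ ^ 2 + ‖y‖ ^ 2 / t - 2 * inner ℝ x y
      = ((t * ‖x‖) ^ 2 - 2 * (t * inner ℝ x y) + ‖y‖ ^ 2) / t := by
    field_simp
    ring
  rw [this]
  positivity

/-- The Lyapunov function of the inertial iteration, at the point `x` with last increment `d`. -/
noncomputable def inertialEnergy (α s : ℝ) (x d : E) : ℝ :=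
  ‖x‖ ^ 2 - α * ‖x - d‖ ^ 2 + s * ‖d‖ ^ 2

/-- Here `D` is the next increment. Subtracting Young's inequality for `2⟨b d - D, G⟩` from `hmono`
bounds `2⟨x + D, G⟩` below, and the `‖G‖² / c` terms cancel. What remains is quadratic in `d` and
`D` with cross term `2 (a - c b)⟨d, D⟩`, absorbed at the cost `|a - c b|` in each square; `hp` and
`hq` say that both squares still have coefficient at most `-σ`. The `⟨x, d⟩` term survives only
through `a - α`. -/
theorem inertialEnergy_step {x d D e G : E} {a b c α s σ κ : ℝ} (hc : 0 < c)
    (hG : G = a • d - D + e)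
    (hmono : ‖G‖ ^ 2 / c + κ * ‖x + b • d‖ ^ 2 ≤ 2 * inner ℝ (x + b • d) G)
    (hp : s + σ ≤ 1 - c - |a - c * b|) (hq : |a - c * b| + α + c * b ^ 2 + σ ≤ s) :
    inertialEnergy α s (x + D) D ≤ inertialEnergy α s x d
      + 2 * (a - α) * inner ℝ x d + 2 * inner ℝ x e + 2 * inner ℝ e D
      - κ * ‖x + b • d‖ ^ 2 - σ * ‖D‖ ^ 2 - σ * ‖d‖ ^ 2 := by
  have hY := two_mul_inner_le_sq (b • d - D) G hc
  have hdD : (a - c * b) * (2 * inner ℝ d D) ≤ |a - c * b| * (‖d‖ ^ 2 + ‖D‖ ^ 2) := by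
    have h1 : |2 * inner ℝ d D| ≤ ‖d‖ ^ 2 + ‖D‖ ^ 2 := by
      rw [abs_mul, abs_two]
      nlinarith [abs_real_inner_le_norm d D, sq_nonneg (‖d‖ - ‖D‖)]
    calc (a - c * b) * (2 * inner ℝ d D) ≤ |(a - c * b) * (2 * inner ℝ d D)| := le_abs_self _
      _ = |a - c * b| * |2 * inner ℝ d D| := abs_mul _ _
      _ ≤ _ := mul_le_mul_of_nonneg_left h1 (abs_nonneg _)
  have hp' := mul_le_mul_of_nonneg_right hp (sq_nonneg ‖D‖)
  have hq' := mul_le_mul_of_nonneg_right hq (sq_nonneg ‖d‖)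
  have hxG : inner ℝ x G = a * inner ℝ x d - inner ℝ x D + inner ℝ x e := by
    rw [hG, inner_add_right, inner_sub_right, inner_smul_right]
  have hDG : inner ℝ D G = a * inner ℝ d D - ‖D‖ ^ 2 + inner ℝ e D := by
    rw [hG, inner_add_right, inner_sub_right, inner_smul_right, real_inner_self_eq_norm_sq,
      real_inner_comm D d, real_inner_comm D e]
  have e1 : ‖b • d - D‖ ^ 2 = b ^ 2 * ‖d‖ ^ 2 - 2 * b * inner ℝ d D + ‖D‖ ^ 2 := by
    rw [norm_sub_sq_real, norm_smul, inner_smul_left, mul_pow, Real.norm_eq_abs, sq_abs]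
    simp only [conj_trivial]
    ring
  rw [inner_sub_left, inner_smul_left, e1] at hY
  rw [inner_add_left, inner_smul_left] at hmono
  simp only [conj_trivial] at hY hmono
  simp only [inertialEnergy, add_sub_cancel_right]
  rw [norm_add_sq_real x D, norm_sub_sq_real x d]
  linarith

/-- The gains `κ‖x + b d‖²` and `(σ / 2)‖d‖²` together dominate `(κ / 2)‖x‖²`. This budget pays for
the mismatch `a - α`, for the Young terms of `e`, and for `κ / 8` times the energy, which is at most
`2 (‖x‖² + ‖d‖²)`. -/
theorem inertialEnergy_contraction {x d D e G : E} {a b c α s σ κ : ℝ} (hc : 0 < c)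
    (hα : 0 ≤ α) (hσ : 0 < σ) (hκ : 0 < κ) (hκσ : κ ≤ σ / 2) (hb : b ∈ Set.Icc (0 : ℝ) 1)
    (haα : |a - α| ≤ κ / 8) (hG : G = a • d - D + e)
    (hmono : ‖G‖ ^ 2 / c + κ * ‖x + b • d‖ ^ 2 ≤ 2 * inner ℝ (x + b • d) G)
    (hp : s + σ ≤ 1 - c - |a - c * b|) (hq : |a - c * b| + α + c * b ^ 2 + σ ≤ s) :
    inertialEnergy α s (x + D) D
      ≤ (1 - κ / 8) * inertialEnergy α s x d + (8 / κ + 1 / σ) * ‖e‖ ^ 2 := by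
  have h1 := inertialEnergy_step hc hG hmono hp hq
  have hs0 : 0 ≤ s := by
    have := abs_nonneg (a - c * b)
    have : 0 ≤ c * b ^ 2 := by positivity
    linarith
  have hs1 : s ≤ 1 := by
    have := abs_nonneg (a - c * b)
    linarith
  have h2 : ‖x‖ ^ 2 ≤ 2 * ‖x + b • d‖ ^ 2 + 2 * ‖d‖ ^ 2 := by
    have h3 : ‖x‖ ≤ ‖x + b • d‖ + ‖d‖ := by
      calc ‖x‖ = ‖(x + b • d) - b • d‖ := by simp
        _ ≤ ‖x + b • d‖ + ‖b • d‖ := norm_sub_le _ _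
        _ ≤ _ := by
          rw [norm_smul, Real.norm_of_nonneg hb.1]
          nlinarith [norm_nonneg d, hb.2]
    nlinarith [norm_nonneg x, sq_nonneg (‖x + b • d‖ - ‖d‖)]
  have h4 : 2 * (a - α) * inner ℝ x d ≤ κ / 8 * (‖x‖ ^ 2 + ‖d‖ ^ 2) := by
    have h5 : |2 * inner ℝ x d| ≤ ‖x‖ ^ 2 + ‖d‖ ^ 2 := by
      rw [abs_mul, abs_two]
      nlinarith [abs_real_inner_le_norm x d, sq_nonneg (‖x‖ - ‖d‖)]
    calc 2 * (a - α) * inner ℝ x d = (a - α) * (2 * inner ℝ x d) := by ring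
      _ ≤ |(a - α) * (2 * inner ℝ x d)| := le_abs_self _
      _ = |a - α| * |2 * inner ℝ x d| := abs_mul _ _
      _ ≤ _ := mul_le_mul haα h5 (abs_nonneg _) (by positivity)
  have h6 := two_mul_inner_le_sq x e (show 0 < κ / 8 by positivity)
  have h7 := two_mul_inner_le_sq D e hσ
  rw [real_inner_comm] at h7
  have h8 : inertialEnergy α s x d ≤ 2 * (‖x‖ ^ 2 + ‖d‖ ^ 2) := by
    have : 0 ≤ α * ‖x - d‖ ^ 2 := by positivity
    have : s * ‖d‖ ^ 2 ≤ 1 * ‖d‖ ^ 2 := by gcongr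
    simp only [inertialEnergy]
    nlinarith [sq_nonneg ‖x‖, sq_nonneg ‖d‖]
  have h9 : (8 / κ + 1 / σ) * ‖e‖ ^ 2 = ‖e‖ ^ 2 / (κ / 8) + ‖e‖ ^ 2 / σ := by
    field_simp
  rw [h9]
  have h10 := mul_le_mul_of_nonneg_left h8 (show 0 ≤ κ / 8 by positivity)
  have h11 := mul_le_mul_of_nonneg_left h2 (show 0 ≤ κ / 2 by positivity)
  have h12 := mul_le_mul_of_nonneg_right hκσ (sq_nonneg ‖d‖)
  have h13 : 0 ≤ κ * ‖x‖ ^ 2 := by positivity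
  have h14 : 0 ≤ κ * ‖d‖ ^ 2 := by positivity
  nlinarith

theorem inertial_tendsto_zero {u g e : ℕ → E} {a b γ : ℕ → ℝ} {a' b' γ' L μ : ℝ}
    (hL : 0 < L) (hμ : 0 < μ) (hb : ∀ k, b k ∈ Set.Icc (0 : ℝ) 1) (hγ : ∀ k, 0 < γ k)
    (ha' : 0 ≤ a') (hγ' : 0 < γ')
    (hlima : Tendsto a atTop (𝓝 a')) (hlimb : Tendsto b atTop (𝓝 b'))
    (hlimγ : Tendsto γ atTop (𝓝 γ'))
    (hpq : 2 * |a' - γ' * L / 2 * b'| + a' + γ' * L / 2 * b' ^ 2 + γ' * L / 2 < 1)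
    (hrec : ∀ k, u (k + 2) = u (k + 1) + a k • (u (k + 1) - u k) - γ k • g k + e k)
    (hco : ∀ k, ‖g k‖ ^ 2 / L ≤ inner ℝ (u (k + 1) + b k • (u (k + 1) - u k)) (g k))
    (hmono : ∀ k, μ * ‖u (k + 1) + b k • (u (k + 1) - u k)‖ ^ 2
      ≤ inner ℝ (u (k + 1) + b k • (u (k + 1) - u k)) (g k))
    (he : Tendsto e atTop (𝓝 0)) : Tendsto u atTop (𝓝 0) := by
  have hc0 : 0 < γ' * L / 2 := by positivity
  -- Taking `c` slightly above `γ' L / 2` keeps the strict margin and leaves the fraction `1 - γ L /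
  -- (2 c)` of the inner product free for strong monotonicity.
  obtain ⟨c, hcF, hc⟩ : ∃ c, 2 * |a' - c * b'| + a' + c * b' ^ 2 + c < 1 ∧ γ' * L / 2 < c := by
    have hcont : ContinuousAt (fun c : ℝ => 2 * |a' - c * b'| + a' + c * b' ^ 2 + c)
        (γ' * L / 2) := by fun_prop
    have h1 := (hcont.tendsto.mono_left (nhdsWithin_le_nhds (s := Set.Ioi (γ' * L / 2))))
      |>.eventually_lt_const hpq
    exact (h1.and self_mem_nhdsWithin).exists
  have hcpos : 0 < c := hc0.trans hc
  have ha1 : a' < 1 := by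
    have : 0 ≤ |a' - c * b'| := abs_nonneg _
    have : 0 ≤ c * b' ^ 2 := by positivity
    linarith
  obtain ⟨s, σ, hσ, hp, hq⟩ : ∃ s σ : ℝ, 0 < σ ∧ s + σ < 1 - c - |a' - c * b'| ∧
      |a' - c * b'| + a' + c * b' ^ 2 + σ < s := by
    -- `s` is the midpoint of the interval left open by the two requirements, and `σ` is a quarter
    -- of its length.
    refine ⟨(1 - c + a' + c * b' ^ 2) / 2,
      (1 - (2 * |a' - c * b'| + a' + c * b' ^ 2 + c)) / 4, ?_, ?_, ?_⟩ <;> linarith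
  have hp' : ∀ᶠ k in atTop, s + σ ≤ 1 - c - |a k - c * b k| := by
    have h1 : Tendsto (fun k => 1 - c - |a k - c * b k|) atTop (𝓝 (1 - c - |a' - c * b'|)) :=
      tendsto_const_nhds.sub (hlima.sub (hlimb.const_mul c)).abs
    exact (h1.eventually_const_lt hp).mono fun _ h => h.le
  have hq' : ∀ᶠ k in atTop, |a k - c * b k| + a' + c * b k ^ 2 + σ ≤ s := by
    have h1 : Tendsto (fun k => |a k - c * b k| + a' + c * b k ^ 2 + σ) atTop
        (𝓝 (|a' - c * b'| + a' + c * b' ^ 2 + σ)) :=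
      (((hlima.sub (hlimb.const_mul c)).abs.add_const a').add ((hlimb.pow 2).const_mul c)).add_const σ
    exact (h1.eventually_lt_const hq).mono fun _ h => h.le
  obtain ⟨κ, hκ, hκσ, hκk⟩ : ∃ κ, 0 < κ ∧ κ ≤ σ / 2 ∧
      ∀ᶠ k in atTop, κ ≤ 2 * γ k * (1 - γ k * L / (2 * c)) * μ := by
    have h1 : Tendsto (fun k => 2 * γ k * (1 - γ k * L / (2 * c)) * μ) atTop
        (𝓝 (2 * γ' * (1 - γ' * L / (2 * c)) * μ)) :=
      ((hlimγ.const_mul 2).mul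
        (tendsto_const_nhds.sub ((hlimγ.mul_const L).div_const (2 * c)))).mul_const μ
    have h2 : 0 < 2 * γ' * (1 - γ' * L / (2 * c)) * μ := by
      have : γ' * L / (2 * c) < 1 := by
        rw [div_lt_one (by positivity)]
        linarith
      have : 0 < 1 - γ' * L / (2 * c) := by linarith
      positivity
    refine ⟨min (σ / 2) (2 * γ' * (1 - γ' * L / (2 * c)) * μ / 2),
      lt_min (by positivity) (by positivity), min_le_left _ _, ?_⟩
    exact (h1.eventually_const_lt ((min_le_right _ _).trans_lt (half_lt_self h2))).mono
      fun _ h => h.le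
  have hak : ∀ᶠ k in atTop, |a k - a'| ≤ κ / 8 := by
    have h1 : Tendsto (fun k => |a k - a'|) atTop (𝓝 0) := by
      simpa using (hlima.sub_const a').abs
    exact (h1.eventually_lt_const (by positivity)).mono fun _ h => h.le
  have hck : ∀ᶠ k in atTop, γ k * L / 2 < c :=
    ((hlimγ.mul_const L).div_const 2).eventually_lt_const hc
  have hV : ∀ᶠ k in atTop, inertialEnergy a' s (u (k + 1 + 1)) (u (k + 1 + 1) - u (k + 1))
      ≤ (1 - κ / 8) * inertialEnergy a' s (u (k + 1)) (u (k + 1) - u k)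
        + (8 / κ + 1 / σ) * ‖e k‖ ^ 2 := by
    filter_upwards [hp', hq', hκk, hak, hck] with k h1 h2 h3 h4 h5
    have h6 := inertialEnergy_contraction (x := u (k + 1)) (d := u (k + 1) - u k)
      (D := u (k + 2) - u (k + 1)) (e := e k) (G := γ k • g k) (b := b k) hcpos ha' hσ hκ hκσ (hb k)
      h4 (by rw [hrec k]; abel) ?_ h1 h2
    · simpa using h6
    · have hγk := hγ k
      have hl : 0 ≤ 1 - γ k * L / (2 * c) := by
        rw [sub_nonneg, div_le_one (by positivity)]
        linarith
      rw [inner_smul_right, norm_smul, mul_pow, Real.norm_eq_abs, sq_abs]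
      -- `2 γ⟨y, g⟩` is split with weights `γ L / (2 c)` and `1 - γ L / (2 c)`: cocoercivity turns
      -- the first share into `‖γ g‖² / c`, strong monotonicity turns the second into the `κ` term.
      have h7 := mul_le_mul_of_nonneg_left (hco k)
        (show 0 ≤ 2 * γ k * (γ k * L / (2 * c)) by positivity)
      have h8 := mul_le_mul_of_nonneg_left (hmono k)
        (show 0 ≤ 2 * γ k * (1 - γ k * L / (2 * c)) by positivity)
      have h9 := mul_le_mul_of_nonneg_right h3
        (sq_nonneg ‖u (k + 1) + b k • (u (k + 1) - u k)‖)
      have h10 : 2 * γ k * (γ k * L / (2 * c)) * (‖g k‖ ^ 2 / L) = γ k ^ 2 * ‖g k‖ ^ 2 / c := by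
        field_simp
      rw [h10] at h7
      linarith
  have hσ4 : κ < 8 := by
    have : 0 ≤ |a' - c * b'| := abs_nonneg _
    have : 0 ≤ c * b' ^ 2 := by positivity
    linarith
  have he2 : Tendsto (fun k => (8 / κ + 1 / σ) * ‖e k‖ ^ 2) atTop (𝓝 0) := by
    simpa using (he.norm.pow 2).const_mul (8 / κ + 1 / σ)
  have hVle : ∀ ε > 0, ∀ᶠ k in atTop,
      inertialEnergy a' s (u (k + 1)) (u (k + 1) - u k) ≤ ε := fun ε hε =>
    eventually_le_of_contraction (by linarith) (by linarith) he2 hV hε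
  have hs0 : 0 ≤ s := by
    have : 0 ≤ |a' - c * b'| := abs_nonneg _
    have : 0 ≤ c * b' ^ 2 := by positivity
    linarith
  have hsq : ∀ ε > 0, ∀ᶠ k in atTop, ‖u k‖ ^ 2 ≤ ε := by
    intro ε hε
    -- Dropping the `s` term from the energy bound leaves a second contraction, now for `‖u k‖²`,
    -- with factor `a' < 1`.
    have h1 : ∀ᶠ k in atTop, ‖u (k + 1)‖ ^ 2 - ε / 2 ≤
        a' * (‖u k‖ ^ 2 - ε / 2) + (fun _ : ℕ => (0 : ℝ)) k := by
      filter_upwards [hVle ((1 - a') * (ε / 2)) (mul_pos (by linarith) (by linarith))] with k hk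
      simp only [inertialEnergy, sub_sub_cancel] at hk
      have : 0 ≤ s * ‖u (k + 1) - u k‖ ^ 2 := by positivity
      linarith
    filter_upwards [eventually_le_of_contraction (u := fun k => ‖u k‖ ^ 2 - ε / 2)
      (δ := fun _ => 0) ha' ha1 tendsto_const_nhds h1 (half_pos hε)]
      with k hk
    linarith
  rw [tendsto_zero_iff_norm_tendsto_zero, Metric.tendsto_atTop]
  intro ε hε
  obtain ⟨N, hN⟩ := eventually_atTop.1 (hsq ((ε / 2) ^ 2) (by positivity))
  refine ⟨N, fun k hk => ?_⟩
  have := abs_le_of_sq_le_sq' (hN k hk) (by positivity)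
  rw [dist_zero_right, norm_norm]
  linarith

end Lyapunov

/-! ### Gradients of smooth strongly convex functions -/

section Gradient

variable {E : Type*} [NormedAddCommGroup E] [InnerProductSpace ℝ E] [CompleteSpace E]

theorem HasGradientAt.hasDerivAt_line {φ : E → ℝ} {g x v : E} {t : ℝ}
    (h : HasGradientAt φ g (x + t • v)) : HasDerivAt (fun s : ℝ => φ (x + s • v)) (inner ℝ g v) t := by
  have h1 : HasDerivAt (fun s : ℝ => x + s • v) v t := by
    simpa using ((hasDerivAt_id t).smul_const v).const_add x
  simpa using! h.hasFDerivAt.comp_hasDerivAt t h1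

/-- After subtraction of `μ / 2 * ‖·‖²` this is the tangent inequality for a convex function on the
line through `x` and `y`. -/
theorem StrongConvexOn.add_inner_gradient_le {φ : E → ℝ} {μ : ℝ}
    (hφ : StrongConvexOn Set.univ μ φ) {g x : E} (hg : HasGradientAt φ g x) (y : E) :
    φ x + inner ℝ g (y - x) + μ / 2 * ‖y - x‖ ^ 2 ≤ φ y := by
  have hψ := (strongConvexOn_iff_convex.1 hφ).comp_affineMap (AffineMap.lineMap (k := ℝ) x y)
  have hline : ∀ t : ℝ, AffineMap.lineMap (k := ℝ) x y t = x + t • (y - x) := fun t => by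
    rw [AffineMap.lineMap_apply, vsub_eq_sub, vadd_eq_add, add_comm]
  have hd : HasDerivAt ((fun z => φ z - μ / 2 * ‖z‖ ^ 2) ∘ AffineMap.lineMap (k := ℝ) x y)
      (inner ℝ g (y - x) - μ / 2 * (2 * inner ℝ x (y - x))) 0 := by
    have h1 : HasDerivAt (fun s : ℝ => φ (x + s • (y - x))) (inner ℝ g (y - x)) 0 :=
      HasGradientAt.hasDerivAt_line (by simpa using hg)
    have h2 : HasDerivAt (fun s : ℝ => x + s • (y - x)) (y - x) 0 := by
      simpa using ((hasDerivAt_id (0 : ℝ)).smul_const (y - x)).const_add x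
    have h3 := h2.norm_sq
    simp only [zero_smul, add_zero] at h3
    refine (h1.sub (h3.const_mul (μ / 2))).congr_of_eventuallyEq (Eventually.of_forall fun t => ?_)
    simp [hline]
  have h := hψ.le_slope_of_hasDerivAt (x := 0) (y := 1) (by simp) (by simp) one_pos hd
  simp only [slope_def_field, Function.comp_apply, AffineMap.lineMap_apply_one,
    AffineMap.lineMap_apply_zero, sub_zero, div_one] at h
  have h4 : ‖y‖ ^ 2 = ‖x‖ ^ 2 + 2 * inner ℝ x (y - x) + ‖y - x‖ ^ 2 := by
    rw [← norm_add_sq_real, add_sub_cancel]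
  rw [h4] at h
  linarith

theorem strong_monotone_gradient {φ : E → ℝ} {G : E → E} {μ : ℝ}
    (hφ : StrongConvexOn Set.univ μ φ) (hG : ∀ x, HasGradientAt φ (G x) x) (x y : E) :
    μ * ‖y - x‖ ^ 2 ≤ inner ℝ (y - x) (G y - G x) := by
  have h1 := hφ.add_inner_gradient_le (hG x) y
  have h2 := hφ.add_inner_gradient_le (hG y) x
  rw [norm_sub_rev x y, ← neg_sub y x, inner_neg_right] at h2
  rw [real_inner_comm, inner_sub_left]
  linarith

/-- The descent lemma, obtained by comparing derivatives along the segment, so that no integral is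
needed. -/
theorem le_add_inner_gradient_add_sq {φ : E → ℝ} {G : E → E} {L : ℝ}
    (hG : ∀ x, HasGradientAt φ (G x) x) (hL : ∀ x y, ‖G x - G y‖ ≤ L * ‖x - y‖) (x y : E) :
    φ y ≤ φ x + inner ℝ (G x) (y - x) + L / 2 * ‖y - x‖ ^ 2 := by
  set v := y - x with hv
  have hd : ∀ t : ℝ, HasDerivAt (fun s : ℝ => φ (x + s • v)) (inner ℝ (G (x + t • v)) v) t :=
    fun t => (hG _).hasDerivAt_line
  have hB : ∀ t : ℝ, HasDerivAt
      (fun s : ℝ => φ x + s * inner ℝ (G x) v + L / 2 * ‖v‖ ^ 2 * s ^ 2)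
      (inner ℝ (G x) v + L * ‖v‖ ^ 2 * t) t := fun t => by
    have h1 := (((hasDerivAt_id t).mul_const (inner ℝ (G x) v)).const_add (φ x)).add
      ((hasDerivAt_pow 2 t).const_mul (L / 2 * ‖v‖ ^ 2))
    refine h1.congr_deriv ?_
    simp
    ring
  have h := image_le_of_deriv_right_le_deriv_boundary (a := 0) (b := 1)
    (fun t _ => (hd t).continuousAt.continuousWithinAt) (fun t _ => (hd t).hasDerivWithinAt)
    (B := fun s : ℝ => φ x + s * inner ℝ (G x) v + L / 2 * ‖v‖ ^ 2 * s ^ 2) (by simp)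
    (fun t _ => (hB t).continuousAt.continuousWithinAt) (fun t _ => (hB t).hasDerivWithinAt)
    (fun t ht => ?_) (Set.right_mem_Icc.2 zero_le_one)
  · simpa [hv] using h
  · have h1 : inner ℝ (G (x + t • v) - G x) v ≤ L * ‖v‖ ^ 2 * t := by
      calc inner ℝ (G (x + t • v) - G x) v ≤ ‖G (x + t • v) - G x‖ * ‖v‖ := real_inner_le_norm _ _
        _ ≤ (L * ‖x + t • v - x‖) * ‖v‖ := by gcongr; exact hL _ _
        _ = L * ‖v‖ ^ 2 * t := by
          rw [add_sub_cancel_left, norm_smul, Real.norm_of_nonneg ht.1]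
          ring
    rw [inner_sub_left] at h1
    linarith

/-- Baillon–Haddad: the tangent bound at `x` and the descent bound at `y` are compared at the
gradient-step point `z = y - (1 / L) (G y - G x)`. Adding the result to its copy with `x` and `y`
exchanged removes the function values. -/
theorem cocoercive_gradient {φ : E → ℝ} {G : E → E} {L μ : ℝ} (hμ : 0 ≤ μ) (hL0 : 0 < L)
    (hφ : StrongConvexOn Set.univ μ φ) (hG : ∀ x, HasGradientAt φ (G x) x)
    (hL : ∀ x y, ‖G x - G y‖ ≤ L * ‖x - y‖) (x y : E) :
    ‖G y - G x‖ ^ 2 / L ≤ inner ℝ (y - x) (G y - G x) := by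
  have key : ∀ x y, φ x + inner ℝ (G x) (y - x) + ‖G y - G x‖ ^ 2 / (2 * L) ≤ φ y := by
    intro x y
    set w := G y - G x with hw
    set z := y - (1 / L) • w with hz
    have h1 := hφ.add_inner_gradient_le (hG x) z
    have h2 := le_add_inner_gradient_add_sq hG hL y z
    have h3 : z - x = (y - x) - (1 / L) • w := by rw [hz]; abel
    have h4 : z - y = -((1 / L) • w) := by rw [hz]; abel
    have h5 : 0 ≤ μ / 2 * ‖z - x‖ ^ 2 := by positivity
    have h6 : inner ℝ (G y) w - inner ℝ (G x) w = ‖w‖ ^ 2 := by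
      rw [← inner_sub_left, ← hw, real_inner_self_eq_norm_sq]
    rw [h3, inner_sub_right, inner_smul_right] at h1
    rw [h4, inner_neg_right, inner_smul_right, norm_neg, norm_smul, mul_pow, Real.norm_eq_abs,
      sq_abs] at h2
    have h7 : L / 2 * ((1 / L) ^ 2 * ‖w‖ ^ 2) = ‖w‖ ^ 2 / (2 * L) := by field_simp
    have h8 : 1 / L * inner ℝ (G y) w = 1 / L * inner ℝ (G x) w + 2 * (‖w‖ ^ 2 / (2 * L)) := by
      rw [← h6]; field_simp; ring
    rw [h3] at h5
    linarith
  have h1 := key x y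
  have h2 := key y x
  rw [norm_sub_rev (G x) (G y), ← neg_sub y x, inner_neg_right] at h2
  have h3 : ‖G y - G x‖ ^ 2 / L = 2 * (‖G y - G x‖ ^ 2 / (2 * L)) := by field_simp
  rw [real_inner_comm, inner_sub_left, h3]
  linarith

end Gradient

/-! ### Monotonicity bounds inherited by the derivative -/

section Linearization

variable {E : Type*} [NormedAddCommGroup E] [InnerProductSpace ℝ E]

theorem HasFDerivAt.tendsto_smul_sub {G : E → E} {H : E →L[ℝ] E} {y : E} (hH : HasFDerivAt G H y)
    (v : E) : Tendsto (fun t : ℝ => t⁻¹ • (G (y + t • v) - G y)) (𝓝[>] 0) (𝓝 (H v)) := by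
  have h1 : HasDerivAt (fun s : ℝ => y + s • v) v 0 := by
    simpa using ((hasDerivAt_id (0 : ℝ)).smul_const v).const_add y
  have h2 : HasDerivAt (fun s : ℝ => G (y + s • v)) (H v) 0 :=
    HasFDerivAt.comp_hasDerivAt (0 : ℝ) (by simpa using hH) h1
  simpa using h2.tendsto_slope_zero_right

theorem strong_monotone_fderiv {G : E → E} {H : E →L[ℝ] E} {y : E} {μ : ℝ}
    (hH : HasFDerivAt G H y)
    (hG : ∀ x y, μ * ‖y - x‖ ^ 2 ≤ inner ℝ (y - x) (G y - G x)) (v : E) :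
    μ * ‖v‖ ^ 2 ≤ inner ℝ v (H v) := by
  refine ge_of_tendsto (tendsto_const_nhds.inner (hH.tendsto_smul_sub v)) ?_
  filter_upwards [self_mem_nhdsWithin] with t ht
  have ht : 0 < t := ht
  have h := hG y (y + t • v)
  rw [add_sub_cancel_left, norm_smul, inner_smul_left, mul_pow, Real.norm_eq_abs, sq_abs] at h
  simp only [conj_trivial] at h
  rw [inner_smul_right, inv_mul_eq_div, le_div_iff₀ ht]
  nlinarith

theorem cocoercive_fderiv {G : E → E} {H : E →L[ℝ] E} {y : E} {L : ℝ}
    (hH : HasFDerivAt G H y)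
    (hG : ∀ x y, ‖G y - G x‖ ^ 2 / L ≤ inner ℝ (y - x) (G y - G x)) (v : E) :
    ‖H v‖ ^ 2 / L ≤ inner ℝ v (H v) := by
  have hq := hH.tendsto_smul_sub v
  refine le_of_tendsto_of_tendsto ((hq.norm.pow 2).div_const L) (tendsto_const_nhds.inner hq) ?_
  filter_upwards [self_mem_nhdsWithin] with t ht
  have ht : 0 < t := ht
  have h := hG y (y + t • v)
  rw [add_sub_cancel_left, inner_smul_left] at h
  simp only [conj_trivial] at h
  rw [inner_smul_right, norm_smul, mul_pow, norm_inv, inv_pow, Real.norm_eq_abs, sq_abs,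
    inv_mul_eq_div t, le_div_iff₀ ht]
  calc (t ^ 2)⁻¹ * ‖G (y + t • v) - G y‖ ^ 2 / L * t
      = t⁻¹ * (‖G (y + t • v) - G y‖ ^ 2 / L) := by field_simp
    _ ≤ t⁻¹ * (t * inner ℝ v (G (y + t • v) - G y)) := by gcongr
    _ = _ := by field_simp

end Linearization

/-- Since the solution branch `x` is given and satisfies a Lipschitz bound at `θ`, differentiability
of `g` at the single point `(x θ, θ)` suffices: coercivity makes the partial derivative in `x`
invertible and converts the first-order remainder of `g` into that of `x`. -/
theorem differentiableAt_of_zero_of_coercive {E P : Type*} [NormedAddCommGroup E]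
    [InnerProductSpace ℝ E] [FiniteDimensional ℝ E] [NormedAddCommGroup P] [NormedSpace ℝ P]
    {g : E × P → E} {D : E × P →L[ℝ] E} {x : P → E} {θ : P} {μ C : ℝ} (hμ : 0 < μ)
    (hD : HasFDerivAt g D (x θ, θ)) (hzero : ∀ᶠ θ' in 𝓝 θ, g (x θ', θ') = 0)
    (hlip : ∀ᶠ θ' in 𝓝 θ, ‖x θ' - x θ‖ ≤ C * ‖θ' - θ‖)
    (hcoer : ∀ v, μ * ‖v‖ ^ 2 ≤ inner ℝ v (D (v, 0))) : DifferentiableAt ℝ x θ := by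
  have hbound : ∀ v, ‖v‖ ≤ μ⁻¹ * ‖D (v, 0)‖ := by
    intro v
    rcases eq_or_ne v 0 with rfl | hv
    · simp only [norm_zero]; positivity
    · have h1 := (hcoer v).trans (real_inner_le_norm v (D (v, 0)))
      have hv' : 0 < ‖v‖ := norm_pos_iff.2 hv
      rw [inv_mul_eq_div, le_div_iff₀ hμ]
      nlinarith
  set H : E →L[ℝ] E := D.comp (ContinuousLinearMap.inl ℝ E P) with hH
  have hHv : ∀ v, H v = D (v, 0) := fun v => rfl
  have hinj : Function.Injective (H : E →ₗ[ℝ] E) := by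
    rw [← LinearMap.ker_eq_bot, LinearMap.ker_eq_bot']
    intro v hv
    have h1 := hbound v
    have h2 : D (v, 0) = 0 := hv
    rw [h2, norm_zero, mul_zero] at h1
    exact norm_le_zero_iff.1 h1
  set e := (LinearEquiv.ofInjectiveEndo (H : E →ₗ[ℝ] E) hinj).toContinuousLinearEquiv with he
  have hev : ∀ v, D (v, 0) = e v := fun v => rfl
  -- The candidate given by implicit differentiation, `-(∂ₓg)⁻¹ ∂_θ g`.
  set T : P →L[ℝ] E :=
    -((e.symm : E →L[ℝ] E).comp (D.comp (ContinuousLinearMap.inr ℝ E P))) with hT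
  have hTw : ∀ w, D (T w, 0) = -D (0, w) := by
    intro w
    rw [hev, hT]
    simp
  refine ⟨T, ?_⟩
  have hxO : (fun θ' => x θ' - x θ) =O[𝓝 θ] fun θ' => θ' - θ := .of_bound C hlip
  have hxc : Tendsto x (𝓝 θ) (𝓝 (x θ)) := by
    have h1 : Tendsto (fun θ' => θ' - θ) (𝓝 θ) (𝓝 0) := by
      simpa using (tendsto_id (x := 𝓝 θ)).sub_const θ
    simpa using (hxO.trans_tendsto h1).add_const (x θ)
  have hp : Tendsto (fun θ' => (x θ', θ')) (𝓝 θ) (𝓝 (x θ, θ)) := hxc.prodMk_nhds tendsto_id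
  have h1 := (hasFDerivAt_iff_isLittleO.1 hD).comp_tendsto hp
  have h2 : (fun θ' => (x θ', θ') - (x θ, θ)) =O[𝓝 θ] fun θ' => θ' - θ := by
    simpa using hxO.prod_left (Asymptotics.isBigO_refl (fun θ' => θ' - θ) (𝓝 θ))
  have h3 := h1.trans_isBigO h2
  rw [hasFDerivAt_iff_isLittleO]
  refine Asymptotics.IsBigO.trans_isLittleO (.of_bound μ⁻¹ ?_) h3
  filter_upwards [hzero] with θ' h4
  -- Both values of `g` on the branch vanish, so the error of the candidate is mapped exactly to
  -- minus the Taylor remainder.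
  have h5 : D (x θ' - x θ - T (θ' - θ), 0)
      = -(g (x θ', θ') - g (x θ, θ) - D ((x θ', θ') - (x θ, θ))) := by
    have h6 : (x θ' - x θ - T (θ' - θ), (0 : P)) = (x θ' - x θ, 0) - (T (θ' - θ), 0) := by simp
    have h7 : (x θ', θ') - (x θ, θ) = (x θ' - x θ, 0) + (0, θ' - θ) := by simp
    rw [h6, h7, h4, hzero.self_of_nhds, map_sub, map_add, hTw]
    abel
  refine (hbound _).trans ?_
  rw [h5, norm_neg]
  rfl

/-! ### Minimizers and regularity of the partial gradient -/

namespace InertialDiff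

variable {n m : ℕ} {f : Eucl n → Eucl m → ℝ} {Θ : Set (Eucl m)} {θ : Eucl m}

theorem hasFDerivAt_left (hΘ : IsOpen Θ)
    (hf : ContDiffOn ℝ 2 (fun p : Eucl n × Eucl m => f p.1 p.2) (Set.univ ×ˢ Θ)) (hθ : θ ∈ Θ)
    (x : Eucl n) :
    HasFDerivAt (fun y => f y θ)
      ((fderiv ℝ (fun p : Eucl n × Eucl m => f p.1 p.2) (x, θ)).comp
        (ContinuousLinearMap.inl ℝ (Eucl n) (Eucl m))) x := by
  have hmem : Set.univ ×ˢ Θ ∈ 𝓝 (x, θ) := (isOpen_univ.prod hΘ).mem_nhds ⟨trivial, hθ⟩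
  have h1 := ((hf.contDiffAt hmem).differentiableAt (by norm_num)).hasFDerivAt
  exact h1.comp (f := fun y => (y, θ)) x (hasFDerivAt_prodMk_left x θ)

theorem hasGradientAt_gradX (hΘ : IsOpen Θ)
    (hf : ContDiffOn ℝ 2 (fun p : Eucl n × Eucl m => f p.1 p.2) (Set.univ ×ˢ Θ)) (hθ : θ ∈ Θ)
    (x : Eucl n) : HasGradientAt (fun y => f y θ) (gradX f x θ) x :=
  (hasFDerivAt_left hΘ hf hθ x).differentiableAt.hasGradientAt

theorem contDiffOn_gradX (hΘ : IsOpen Θ)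
    (hf : ContDiffOn ℝ 2 (fun p : Eucl n × Eucl m => f p.1 p.2) (Set.univ ×ˢ Θ)) :
    ContDiffOn ℝ 1 (fun p : Eucl n × Eucl m => gradX f p.1 p.2) (Set.univ ×ˢ Θ) := by
  have h1 : ContDiffOn ℝ 1 (fderiv ℝ (fun p : Eucl n × Eucl m => f p.1 p.2)) (Set.univ ×ˢ Θ) :=
    hf.fderiv_of_isOpen (isOpen_univ.prod hΘ) (by norm_num)
  have h2 : ContDiffOn ℝ 1 (fun p : Eucl n × Eucl m => (InnerProductSpace.toDual ℝ (Eucl n)).symm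
      ((fderiv ℝ (fun p : Eucl n × Eucl m => f p.1 p.2) p).comp
        (ContinuousLinearMap.inl ℝ (Eucl n) (Eucl m)))) (Set.univ ×ˢ Θ) :=
    (InnerProductSpace.toDual ℝ (Eucl n)).symm.toContinuousLinearEquiv.contDiff.comp_contDiffOn
      (h1.clm_comp contDiffOn_const)
  refine h2.congr fun p hp => ?_
  rw [gradX, gradient, (hasFDerivAt_left hΘ hf hp.2 p.1).fderiv]

theorem exists_isMinimizer (hc : Continuous fun x => f x θ)
    (hlev : ∀ c : ℝ, Bornology.IsBounded {x : Eucl n | f x θ ≤ c}) :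
    ∃ x, IsMinimizer f θ x := by
  refine hc.exists_forall_le' 0 ?_
  have h := (hlev (f 0 θ)).isCompact_closure.compl_mem_cocompact
  filter_upwards [h] with x hx
  by_contra! h1
  exact hx (subset_closure h1.le)

theorem isMinimizer_xStar (h : ∃ x, IsMinimizer f θ x) : IsMinimizer f θ (xStar f θ) :=
  Classical.epsilon_spec h

theorem IsMinimizer.unique {μ : ℝ} (hμ : 0 < μ)
    (hφ : StrongConvexOn Set.univ μ fun x => f x θ) {x y : Eucl n} (hx : IsMinimizer f θ x)
    (hy : IsMinimizer f θ y) : x = y :=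
  (hφ.strictConvexOn hμ).eq_of_isMinOn (fun z _ => hx z) (fun z _ => hy z) trivial trivial

theorem IsMinimizer.gradX_eq_zero {x : Eucl n} (hx : IsMinimizer f θ x) : gradX f x θ = 0 := by
  have h : IsLocalMin (fun y => f y θ) x := Eventually.of_forall hx
  rw [gradX, gradient, h.fderiv_eq_zero, map_zero]

/-- Strong monotonicity is used only at the base parameter `θ`, so the modulus may vary with the
parameter without any uniformity. -/
theorem norm_xStar_sub_le {μ L : ℝ} (hμ : 0 < μ) {θ' : Eucl m}
    (hmono : ∀ x y, μ * ‖y - x‖ ^ 2 ≤ inner ℝ (y - x) (gradX f y θ - gradX f x θ))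
    (hL : ∀ x, ‖gradX f x θ - gradX f x θ'‖ ≤ L * ‖θ - θ'‖)
    (h0 : gradX f (xStar f θ) θ = 0) (h0' : gradX f (xStar f θ') θ' = 0) :
    ‖xStar f θ' - xStar f θ‖ ≤ L / μ * ‖θ' - θ‖ := by
  have h1 := hmono (xStar f θ) (xStar f θ')
  have h2 := hL (xStar f θ')
  rw [h0, sub_zero] at h1
  rw [h0', sub_zero, norm_sub_rev] at h2
  have h3 := h1.trans (real_inner_le_norm _ _)
  rw [div_mul_eq_mul_div, le_div_iff₀ hμ]
  rcases (norm_nonneg (xStar f θ' - xStar f θ)).eq_or_lt with h4 | h4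
  · rw [← h4, zero_mul]
    exact (norm_nonneg _).trans h2
  · nlinarith

end InertialDiff

/-! ### Operator-norm convergence and the parameter margin -/

theorem tendsto_clm_of_tendsto_apply {P F : Type*} [NormedAddCommGroup P] [NormedSpace ℝ P]
    [FiniteDimensional ℝ P] [NormedAddCommGroup F] [NormedSpace ℝ F] {T : ℕ → P →L[ℝ] F}
    (h : ∀ v, Tendsto (fun k => T k v) atTop (𝓝 0)) : Tendsto T atTop (𝓝 0) := by
  obtain ⟨C, hC, hb⟩ := (Module.finBasis ℝ P).exists_opNorm_le (F := F)
  rw [tendsto_zero_iff_norm_tendsto_zero]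
  have h1 : Tendsto (fun k => C * ∑ i, ‖T k (Module.finBasis ℝ P i)‖) atTop (𝓝 0) := by
    have h2 : Tendsto (fun k => ∑ i, ‖T k (Module.finBasis ℝ P i)‖) atTop
        (𝓝 (∑ _i : Fin (Module.finrank ℝ P), 0)) :=
      tendsto_finsetSum _ fun i _ => by simpa using (h (Module.finBasis ℝ P i)).norm
    simpa using h2.const_mul C
  refine squeeze_zero (fun k => norm_nonneg _) (fun k => ?_) h1
  refine hb (Finset.sum_nonneg fun i _ => norm_nonneg _) fun i => ?_
  exact Finset.single_le_sum (f := fun i => ‖T k (Module.finBasis ℝ P i)‖)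
    (fun i _ => norm_nonneg _) (Finset.mem_univ i)

/-- Expanding the squares, the left-hand side equals `c (1 + b)² - a` when `a < c b` and `3 a + c (1
- b)²` when `c b ≤ a`. The alternative `b ≤ a` belongs to the second case because `c < 1`. -/
theorem inertial_margin_of_cases {a b c τ : ℝ} (hb : 0 ≤ b) (hc : c < 1)
    (h : (a < c * b ∧ τ < (1 + a) - c * (1 + b) ^ 2) ∨
      ((b ≤ a ∨ (c * b ≤ a ∧ a < b)) ∧ τ < (1 - 3 * a) - c * (1 - b) ^ 2)) :
    2 * |a - c * b| + a + c * b ^ 2 + c ≤ 1 - τ := by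
  rcases h with ⟨h1, h2⟩ | ⟨h1, h2⟩
  · rw [abs_of_neg (by linarith)]
    nlinarith
  · have h3 : c * b ≤ a := by
      rcases h1 with h1 | h1
      · nlinarith
      · exact h1.1
    rw [abs_of_nonneg (by linarith)]
    nlinarith

theorem inertial_margin_limit {a b γ : ℕ → ℝ} {a' b' γ' L τ : ℝ} (hτ : 0 < τ) (hL : 0 < L)
    (hb : ∀ k, b k ∈ Set.Icc (0 : ℝ) 1)
    (hγ : ∀ k, γ k ∈ Set.Ioo 0 (2 / L))
    (hB : ∀ k, 1 ≤ k →
      (a k < γ k * L / 2 * b k ∧ τ < (1 + a k) - γ k * L / 2 * (1 + b k) ^ 2) ∨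
      ((b k ≤ a k ∨ (γ k * L / 2 * b k ≤ a k ∧ a k < b k)) ∧
        τ < (1 - 3 * a k) - γ k * L / 2 * (1 - b k) ^ 2))
    (hlima : Tendsto a atTop (𝓝 a')) (hlimb : Tendsto b atTop (𝓝 b'))
    (hlimγ : Tendsto γ atTop (𝓝 γ')) :
    2 * |a' - γ' * L / 2 * b'| + a' + γ' * L / 2 * b' ^ 2 + γ' * L / 2 < 1 := by
  have hc := (hlimγ.mul_const L).div_const 2
  have h1 := ((((hlima.sub (hc.mul hlimb)).abs.const_mul 2).add hlima).add
    (hc.mul (hlimb.pow 2))).add hc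
  have h2 : 2 * |a' - γ' * L / 2 * b'| + a' + γ' * L / 2 * b' ^ 2 + γ' * L / 2 ≤ 1 - τ := by
    refine le_of_tendsto h1 ?_
    filter_upwards [eventually_ge_atTop 1] with k hk
    refine inertial_margin_of_cases (hb k).1 ?_ (hB k hk)
    have := (lt_div_iff₀ hL).1 (hγ k).2
    linarith
  linarith

/-! ### The iterates as a second-order recursion, and its derivative -/

namespace InertialDiff

variable {n m : ℕ} {f : Eucl n → Eucl m → ℝ} {Θ : Set (Eucl m)} {θ : Eucl m}
  {a b γ : ℕ → ℝ} {X₀ : Eucl m → State n}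

/-- The iterates as a single sequence of points of `ℝⁿ`, started at `(z₀, x₀)`. -/
noncomputable def inertialSeq (f : Eucl n → Eucl m → ℝ) (a b γ : ℕ → ℝ) (X₀ : Eucl m → State n) :
    ℕ → Eucl m → Eucl n
  | 0 => fun θ => (X₀ θ).snd
  | k + 1 => fun θ => (iterate f a b γ X₀ k θ).fst

theorem iterate_eq_inertialSeq (k : ℕ) (θ : Eucl m) : iterate f a b γ X₀ k θ =
    WithLp.toLp 2 (inertialSeq f a b γ X₀ (k + 1) θ, inertialSeq f a b γ X₀ k θ) := by
  cases k <;> rfl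

/-- The extrapolated point at which the gradient is evaluated. -/
noncomputable def extrapolation (f : Eucl n → Eucl m → ℝ) (a b γ : ℕ → ℝ) (X₀ : Eucl m → State n)
    (k : ℕ) (θ : Eucl m) : Eucl n :=
  inertialSeq f a b γ X₀ (k + 1) θ
    + b k • (inertialSeq f a b γ X₀ (k + 1) θ - inertialSeq f a b γ X₀ k θ)

theorem inertialSeq_succ_succ (k : ℕ) : inertialSeq f a b γ X₀ (k + 2) = fun θ =>
    inertialSeq f a b γ X₀ (k + 1) θ
      + a k • (inertialSeq f a b γ X₀ (k + 1) θ - inertialSeq f a b γ X₀ k θ)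
      - γ k • gradX f (extrapolation f a b γ X₀ k θ) θ := by
  cases k <;> rfl

theorem hasFDerivAt_gradX (hΘ : IsOpen Θ)
    (hf : ContDiffOn ℝ 2 (fun p : Eucl n × Eucl m => f p.1 p.2) (Set.univ ×ˢ Θ)) (hθ : θ ∈ Θ)
    (x : Eucl n) : HasFDerivAt (fun p : Eucl n × Eucl m => gradX f p.1 p.2)
      (fderiv ℝ (fun p : Eucl n × Eucl m => gradX f p.1 p.2) (x, θ)) (x, θ) :=
  (((contDiffOn_gradX hΘ hf).contDiffAt ((isOpen_univ.prod hΘ).mem_nhds ⟨trivial, hθ⟩)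
    ).differentiableAt (by norm_num)).hasFDerivAt

theorem hasFDerivAt_gradX_left (hΘ : IsOpen Θ)
    (hf : ContDiffOn ℝ 2 (fun p : Eucl n × Eucl m => f p.1 p.2) (Set.univ ×ˢ Θ)) (hθ : θ ∈ Θ)
    (x : Eucl n) : HasFDerivAt (fun y => gradX f y θ)
      ((fderiv ℝ (fun p : Eucl n × Eucl m => gradX f p.1 p.2) (x, θ)).comp
        (ContinuousLinearMap.inl ℝ (Eucl n) (Eucl m))) x :=
  (hasFDerivAt_gradX hΘ hf hθ x).comp (f := fun y => (y, θ)) x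
    (hasFDerivAt_prodMk_left x θ)

theorem hasFDerivAt_gradX_along (hΘ : IsOpen Θ)
    (hf : ContDiffOn ℝ 2 (fun p : Eucl n × Eucl m => f p.1 p.2) (Set.univ ×ˢ Θ)) (hθ : θ ∈ Θ)
    {y : Eucl m → Eucl n} {y' : Eucl m →L[ℝ] Eucl n} (hy : HasFDerivAt y y' θ) :
    HasFDerivAt (fun θ => gradX f (y θ) θ)
      ((fderiv ℝ (fun p : Eucl n × Eucl m => gradX f p.1 p.2) (y θ, θ)).comp
        (y'.prod (ContinuousLinearMap.id ℝ (Eucl m)))) θ :=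
  (hasFDerivAt_gradX hΘ hf hθ (y θ)).comp (f := fun θ => (y θ, θ)) θ
    (hy.prodMk (hasFDerivAt_id θ))

theorem hasFDerivAt_extrapolation (k : ℕ)
    (h0 : DifferentiableAt ℝ (inertialSeq f a b γ X₀ k) θ)
    (h1 : DifferentiableAt ℝ (inertialSeq f a b γ X₀ (k + 1)) θ) :
    HasFDerivAt (extrapolation f a b γ X₀ k) (fderiv ℝ (inertialSeq f a b γ X₀ (k + 1)) θ
      + b k • (fderiv ℝ (inertialSeq f a b γ X₀ (k + 1)) θ
        - fderiv ℝ (inertialSeq f a b γ X₀ k) θ)) θ :=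
  h1.hasFDerivAt.add ((h1.hasFDerivAt.sub h0.hasFDerivAt).const_smul (b k))

theorem hasFDerivAt_inertialSeq_succ_succ (hΘ : IsOpen Θ)
    (hf : ContDiffOn ℝ 2 (fun p : Eucl n × Eucl m => f p.1 p.2) (Set.univ ×ˢ Θ)) (hθ : θ ∈ Θ)
    (k : ℕ) (h0 : DifferentiableAt ℝ (inertialSeq f a b γ X₀ k) θ)
    (h1 : DifferentiableAt ℝ (inertialSeq f a b γ X₀ (k + 1)) θ) :
    HasFDerivAt (inertialSeq f a b γ X₀ (k + 2))
      (fderiv ℝ (inertialSeq f a b γ X₀ (k + 1)) θ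
        + a k • (fderiv ℝ (inertialSeq f a b γ X₀ (k + 1)) θ
          - fderiv ℝ (inertialSeq f a b γ X₀ k) θ)
        - γ k • (fderiv ℝ (fun p : Eucl n × Eucl m => gradX f p.1 p.2)
            (extrapolation f a b γ X₀ k θ, θ)).comp
          ((fderiv ℝ (inertialSeq f a b γ X₀ (k + 1)) θ
            + b k • (fderiv ℝ (inertialSeq f a b γ X₀ (k + 1)) θ
              - fderiv ℝ (inertialSeq f a b γ X₀ k) θ)).prod
            (ContinuousLinearMap.id ℝ (Eucl m)))) θ := by
  rw [inertialSeq_succ_succ]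
  exact (h1.hasFDerivAt.add ((h1.hasFDerivAt.sub h0.hasFDerivAt).const_smul (a k))).sub
    ((hasFDerivAt_gradX_along hΘ hf hθ (hasFDerivAt_extrapolation k h0 h1)).const_smul (γ k))

theorem differentiableAt_inertialSeq (hΘ : IsOpen Θ)
    (hf : ContDiffOn ℝ 2 (fun p : Eucl n × Eucl m => f p.1 p.2) (Set.univ ×ˢ Θ)) (hθ : θ ∈ Θ)
    (hX₀ : ContDiffOn ℝ 1 X₀ Θ) (k : ℕ) :
    DifferentiableAt ℝ (inertialSeq f a b γ X₀ k) θ := by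
  have hX : DifferentiableAt ℝ X₀ θ :=
    (hX₀.contDiffAt (hΘ.mem_nhds hθ)).differentiableAt (by norm_num)
  have h : ∀ k, DifferentiableAt ℝ (inertialSeq f a b γ X₀ k) θ ∧
      DifferentiableAt ℝ (inertialSeq f a b γ X₀ (k + 1)) θ := by
    intro k
    induction k with
    | zero =>
      exact ⟨(WithLp.sndL 2 ℝ (Eucl n) (Eucl n)).differentiableAt.comp θ hX,
        (WithLp.fstL 2 ℝ (Eucl n) (Eucl n)).differentiableAt.comp θ hX⟩
    | succ k ih =>
      exact ⟨ih.2, (hasFDerivAt_inertialSeq_succ_succ hΘ hf hθ k ih.1 ih.2).differentiableAt⟩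
  exact (h k).1

end InertialDiff

/-! ### Derivatives of pairs in the doubled space -/

theorem tendsto_comp_prod_sub {P E₁ E₂ F : Type*} [NormedAddCommGroup P] [NormedSpace ℝ P]
    [NormedAddCommGroup E₁] [NormedSpace ℝ E₁] [NormedAddCommGroup E₂] [NormedSpace ℝ E₂]
    [NormedAddCommGroup F] [NormedSpace ℝ F] (S : E₁ × E₂ →L[ℝ] F) {A : ℕ → P →L[ℝ] E₁}
    {B : ℕ → P →L[ℝ] E₂} {A' : P →L[ℝ] E₁} {B' : P →L[ℝ] E₂}
    (hA : Tendsto (fun k => A k - A') atTop (𝓝 0)) (hB : Tendsto (fun k => B k - B') atTop (𝓝 0)) :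
    Tendsto (fun k => S.comp ((A k).prod (B k)) - S.comp (A'.prod B')) atTop (𝓝 0) := by
  have h2 := hA.norm.max hB.norm
  rw [norm_zero, norm_zero, max_self] at h2
  have h3 := h2.const_mul ‖S‖
  rw [mul_zero] at h3
  refine squeeze_zero_norm (fun k => ?_) h3
  rw [← ContinuousLinearMap.comp_sub]
  refine (ContinuousLinearMap.opNorm_comp_le _ _).trans ?_
  gcongr
  refine ContinuousLinearMap.opNorm_le_bound _ (by positivity) fun v => max_le ?_ ?_
  · exact ((A k - A').le_opNorm v).trans
      (mul_le_mul_of_nonneg_right (le_max_left _ _) (norm_nonneg v))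
  · exact ((B k - B').le_opNorm v).trans
      (mul_le_mul_of_nonneg_right (le_max_right _ _) (norm_nonneg v))

section ProdLp

variable {P E : Type*} [NormedAddCommGroup P] [NormedSpace ℝ P] [NormedAddCommGroup E]
  [NormedSpace ℝ E]

theorem hasFDerivAt_toLp_prod {x z : P → E} {θ : P} (hx : DifferentiableAt ℝ x θ)
    (hz : DifferentiableAt ℝ z θ) : HasFDerivAt (fun θ => (WithLp.toLp 2 (x θ, z θ)))
      (((WithLp.prodContinuousLinearEquiv 2 ℝ E E).symm :
        E × E →L[ℝ] WithLp 2 (E × E)).comp ((fderiv ℝ x θ).prod (fderiv ℝ z θ))) θ :=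
  ((WithLp.prodContinuousLinearEquiv 2 ℝ E E).symm :
    E × E →L[ℝ] WithLp 2 (E × E)).hasFDerivAt.comp θ (hx.hasFDerivAt.prodMk hz.hasFDerivAt)

theorem tendsto_fderiv_toLp_prod_sub {x z : ℕ → P → E} {x' z' : P → E} {θ : P}
    (hx : ∀ k, DifferentiableAt ℝ (x k) θ) (hz : ∀ k, DifferentiableAt ℝ (z k) θ)
    (hx' : DifferentiableAt ℝ x' θ) (hz' : DifferentiableAt ℝ z' θ)
    (hxl : Tendsto (fun k => fderiv ℝ (x k) θ - fderiv ℝ x' θ) atTop (𝓝 0))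
    (hzl : Tendsto (fun k => fderiv ℝ (z k) θ - fderiv ℝ z' θ) atTop (𝓝 0)) :
    Tendsto (fun k => fderiv ℝ (fun θ => WithLp.toLp 2 (x k θ, z k θ)) θ
      - fderiv ℝ (fun θ => WithLp.toLp 2 (x' θ, z' θ)) θ) atTop (𝓝 0) := by
  simp_rw [(hasFDerivAt_toLp_prod hx' hz').fderiv,
    fun k => (hasFDerivAt_toLp_prod (hx k) (hz k)).fderiv]
  exact tendsto_comp_prod_sub _ hxl hzl

end ProdLp

/-! ### Convergence of the iterates and of their derivatives -/

namespace InertialDiff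

variable {n m : ℕ} {f : Eucl n → Eucl m → ℝ} {Θ : Set (Eucl m)} {θ : Eucl m}
  {a b γ : ℕ → ℝ} {a' b' γ' L : ℝ} {X₀ : Eucl m → State n}

theorem continuousAt_fderiv_gradX (hΘ : IsOpen Θ)
    (hf : ContDiffOn ℝ 2 (fun p : Eucl n × Eucl m => f p.1 p.2) (Set.univ ×ˢ Θ)) (hθ : θ ∈ Θ)
    (x : Eucl n) :
    ContinuousAt (fderiv ℝ (fun p : Eucl n × Eucl m => gradX f p.1 p.2)) (x, θ) :=
  ((contDiffOn_gradX hΘ hf).contDiffAt ((isOpen_univ.prod hΘ).mem_nhds ⟨trivial, hθ⟩)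
    ).continuousAt_fderiv (by norm_num)

theorem tendsto_inertialSeq {μ : ℝ} (hL : 0 < L) (hμ : 0 < μ)
    (hmono : ∀ x y, μ * ‖y - x‖ ^ 2 ≤ inner ℝ (y - x) (gradX f y θ - gradX f x θ))
    (hco : ∀ x y, ‖gradX f y θ - gradX f x θ‖ ^ 2 / L
      ≤ inner ℝ (y - x) (gradX f y θ - gradX f x θ))
    (h0 : gradX f (xStar f θ) θ = 0)
    (hb : ∀ k, b k ∈ Set.Icc (0 : ℝ) 1) (hγ : ∀ k, 0 < γ k) (ha' : 0 ≤ a') (hγ' : 0 < γ')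
    (hlima : Tendsto a atTop (𝓝 a')) (hlimb : Tendsto b atTop (𝓝 b'))
    (hlimγ : Tendsto γ atTop (𝓝 γ'))
    (hpq : 2 * |a' - γ' * L / 2 * b'| + a' + γ' * L / 2 * b' ^ 2 + γ' * L / 2 < 1) :
    Tendsto (fun k => inertialSeq f a b γ X₀ k θ) atTop (𝓝 (xStar f θ)) := by
  have hy : ∀ k, (inertialSeq f a b γ X₀ (k + 1) θ - xStar f θ)
      + b k • ((inertialSeq f a b γ X₀ (k + 1) θ - xStar f θ)
        - (inertialSeq f a b γ X₀ k θ - xStar f θ))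
      = extrapolation f a b γ X₀ k θ - xStar f θ := fun k => by
    rw [extrapolation, sub_sub_sub_cancel_right]
    abel
  have h := inertial_tendsto_zero (u := fun k => inertialSeq f a b γ X₀ k θ - xStar f θ)
    (g := fun k => gradX f (extrapolation f a b γ X₀ k θ) θ) (e := fun _ => 0) (a := a) (b := b)
    hL hμ hb hγ ha' hγ' hlima hlimb hlimγ hpq (fun k => ?_) (fun k => ?_) (fun k => ?_)
    tendsto_const_nhds
  · simpa using h.add_const (xStar f θ)
  · simp only [inertialSeq_succ_succ, sub_sub_sub_cancel_right, add_zero]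
    abel
  · rw [hy]
    simpa [h0] using hco (xStar f θ) (extrapolation f a b γ X₀ k θ)
  · rw [hy]
    simpa [h0] using hmono (xStar f θ) (extrapolation f a b γ X₀ k θ)

theorem tendsto_extrapolation {x : Eucl n}
    (hx : Tendsto (fun k => inertialSeq f a b γ X₀ k θ) atTop (𝓝 x))
    (hlimb : Tendsto b atTop (𝓝 b')) :
    Tendsto (fun k => extrapolation f a b γ X₀ k θ) atTop (𝓝 x) := by
  have h1 := hx.comp (tendsto_add_atTop_nat 1)
  simpa [extrapolation] using h1.add (hlimb.smul (h1.sub hx))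

theorem tendsto_fderiv_inertialSeq {μ : ℝ} (hΘ : IsOpen Θ)
    (hf : ContDiffOn ℝ 2 (fun p : Eucl n × Eucl m => f p.1 p.2) (Set.univ ×ˢ Θ)) (hθ : θ ∈ Θ)
    (hX₀ : ContDiffOn ℝ 1 X₀ Θ) (hL : 0 < L) (hμ : 0 < μ)
    (hmono : ∀ x y, μ * ‖y - x‖ ^ 2 ≤ inner ℝ (y - x) (gradX f y θ - gradX f x θ))
    (hco : ∀ x y, ‖gradX f y θ - gradX f x θ‖ ^ 2 / L
      ≤ inner ℝ (y - x) (gradX f y θ - gradX f x θ))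
    (h0 : ∀ᶠ θ' in 𝓝 θ, gradX f (xStar f θ') θ' = 0)
    (hdiff : DifferentiableAt ℝ (xStar f) θ)
    (hb : ∀ k, b k ∈ Set.Icc (0 : ℝ) 1) (hγ : ∀ k, 0 < γ k) (ha' : 0 ≤ a') (hγ' : 0 < γ')
    (hlima : Tendsto a atTop (𝓝 a')) (hlimb : Tendsto b atTop (𝓝 b'))
    (hlimγ : Tendsto γ atTop (𝓝 γ'))
    (hpq : 2 * |a' - γ' * L / 2 * b'| + a' + γ' * L / 2 * b' ^ 2 + γ' * L / 2 < 1)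
    (v : Eucl m) :
    Tendsto (fun k => fderiv ℝ (inertialSeq f a b γ X₀ k) θ v) atTop
      (𝓝 (fderiv ℝ (xStar f) θ v)) := by
  set D := fderiv ℝ (fun p : Eucl n × Eucl m => gradX f p.1 p.2) with hD
  set p := fderiv ℝ (xStar f) θ v with hp
  set w : ℕ → Eucl n := fun k => fderiv ℝ (inertialSeq f a b γ X₀ k) θ v with hw
  set y : ℕ → Eucl n := fun k => extrapolation f a b γ X₀ k θ with hy
  have hyl : Tendsto y atTop (𝓝 (xStar f θ)) :=
    tendsto_extrapolation (tendsto_inertialSeq hL hμ hmono hco h0.self_of_nhds hb hγ ha' hγ' hlima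
      hlimb hlimγ hpq) hlimb
  -- Differentiated stationarity; it is the reason the forcing term below tends to zero.
  have hstat : D (xStar f θ, θ) (p, v) = 0 := by
    have h1 := hasFDerivAt_gradX_along hΘ hf hθ hdiff.hasFDerivAt
    have h2 : HasFDerivAt (fun θ' => gradX f (xStar f θ') θ') (0 : Eucl m →L[ℝ] Eucl n) θ :=
      (hasFDerivAt_const (0 : Eucl n) θ).congr_of_eventuallyEq h0
    simpa using congrArg (fun T => T v) (h1.unique h2)
  have hDl : Tendsto (fun k => γ k • D (y k, θ) (p, v)) atTop (𝓝 0) := by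
    have h1 : Tendsto (fun k => D (y k, θ)) atTop (𝓝 (D (xStar f θ, θ))) :=
      (continuousAt_fderiv_gradX hΘ hf hθ _).tendsto.comp (hyl.prodMk_nhds tendsto_const_nhds)
    have h2 := hlimγ.smul (((ContinuousLinearMap.apply ℝ (Eucl n)
      ((p, v) : Eucl n × Eucl m)).continuous.tendsto _).comp h1)
    simp only [ContinuousLinearMap.apply_apply, Function.comp_apply] at h2
    rwa [hstat, smul_zero] at h2
  have hrec : ∀ k, w (k + 2) = w (k + 1) + a k • (w (k + 1) - w k)
      - γ k • D (y k, θ) (w (k + 1) + b k • (w (k + 1) - w k), v) := fun k => by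
    simp only [hw]
    rw [(hasFDerivAt_inertialSeq_succ_succ hΘ hf hθ k
      (differentiableAt_inertialSeq hΘ hf hθ hX₀ k)
      (differentiableAt_inertialSeq hΘ hf hθ hX₀ (k + 1))).fderiv]
    simp [hD, hy]
  -- By linearity `(w, v)` splits into the error part `(·, 0)`, on which the derivative acts as the
  -- Hessian, and the fixed vector `(p, v)`, which becomes the perturbation `e`.
  have h := inertial_tendsto_zero (u := fun k => w k - p) (a := a) (b := b) (γ := γ)
    (g := fun k => D (y k, θ) (w (k + 1) - p + b k • ((w (k + 1) - p) - (w k - p)), 0))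
    (e := fun k => -(γ k • D (y k, θ) (p, v)))
    hL hμ hb hγ ha' hγ' hlima hlimb hlimγ hpq (fun k => ?_)
    (fun k => cocoercive_fderiv (hasFDerivAt_gradX_left hΘ hf hθ (y k)) hco _)
    (fun k => strong_monotone_fderiv (hasFDerivAt_gradX_left hΘ hf hθ (y k)) hmono _)
    (by simpa using hDl.neg)
  · simpa using h.add_const p
  · have h1 : ((w (k + 1) + b k • (w (k + 1) - w k), v) : Eucl n × Eucl m)
        = (w (k + 1) - p + b k • ((w (k + 1) - p) - (w k - p)), 0) + (p, v) := by
      rw [sub_sub_sub_cancel_right, Prod.mk_add_mk, zero_add]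
      congr 1
      abel
    rw [hrec, h1, map_add, smul_add, sub_sub_sub_cancel_right]
    abel

theorem differentiableAt_XStar (h : DifferentiableAt ℝ (xStar f) θ) :
    DifferentiableAt ℝ (XStar f) θ :=
  (hasFDerivAt_toLp_prod h h).differentiableAt

theorem iterate_eq_toLp_inertialSeq (k : ℕ) : iterate f a b γ X₀ k = fun θ =>
    WithLp.toLp 2 (inertialSeq f a b γ X₀ (k + 1) θ, inertialSeq f a b γ X₀ k θ) :=
  funext (iterate_eq_inertialSeq k)

theorem differentiableAt_iterate {k : ℕ} (h0 : DifferentiableAt ℝ (inertialSeq f a b γ X₀ k) θ)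
    (h1 : DifferentiableAt ℝ (inertialSeq f a b γ X₀ (k + 1)) θ) :
    DifferentiableAt ℝ (iterate f a b γ X₀ k) θ := by
  rw [iterate_eq_toLp_inertialSeq]
  exact (hasFDerivAt_toLp_prod h1 h0).differentiableAt

theorem tendsto_fderiv_iterate_sub
    (hxdiff : DifferentiableAt ℝ (xStar f) θ)
    (hsdiff : ∀ k, DifferentiableAt ℝ (inertialSeq f a b γ X₀ k) θ)
    (hlim : ∀ v, Tendsto (fun k => fderiv ℝ (inertialSeq f a b γ X₀ k) θ v) atTop
      (𝓝 (fderiv ℝ (xStar f) θ v))) :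
    Tendsto (fun k => fderiv ℝ (iterate f a b γ X₀ k) θ - fderiv ℝ (XStar f) θ) atTop (𝓝 0) := by
  have h1 : Tendsto (fun k => fderiv ℝ (inertialSeq f a b γ X₀ k) θ - fderiv ℝ (xStar f) θ) atTop
      (𝓝 0) :=
    tendsto_clm_of_tendsto_apply fun v => by
      simpa using (hlim v).sub_const (fderiv ℝ (xStar f) θ v)
  have h2 := tendsto_fderiv_toLp_prod_sub (fun k => hsdiff (k + 1)) hsdiff hxdiff hxdiff
    (h1.comp (tendsto_add_atTop_nat 1)) h1
  simp_rw [iterate_eq_toLp_inertialSeq]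
  exact h2

end InertialDiff

end InertialIteration

theorem theorem3p2 {n m : ℕ}
    -- the open parameter set and the objective
    (Θ : Set (InertialDiff.Eucl m)) (hΘ : IsOpen Θ)
    (f : InertialDiff.Eucl n → InertialDiff.Eucl m → ℝ)
    -- `f` is jointly of class `C²`
    (hf : ContDiffOn ℝ 2 (fun p : InertialDiff.Eucl n × InertialDiff.Eucl m => f p.1 p.2)
      (Set.univ ×ˢ Θ))
    -- `∇ₓ f` is `L`-Lipschitz in `(x, θ)` for the Euclidean norm of the product
    (L : ℝ) (hL : 0 < L)
    (hLip : ∀ x₁ x₂ : InertialDiff.Eucl n, ∀ θ₁ ∈ Θ, ∀ θ₂ ∈ Θ,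
      ‖InertialDiff.gradX f x₁ θ₁ - InertialDiff.gradX f x₂ θ₂‖
        ≤ L * Real.sqrt (‖x₁ - x₂‖ ^ 2 + ‖θ₁ - θ₂‖ ^ 2))
    -- level boundedness and strong convexity in `x`
    (hlev : ∀ θ ∈ Θ, ∀ c : ℝ, Bornology.IsBounded {x : InertialDiff.Eucl n | f x θ ≤ c})
    (hconv : ∀ θ ∈ Θ, ∃ μ : ℝ, 0 < μ ∧ StrongConvexOn Set.univ μ (fun x => f x θ))
    -- inertial parameters and step sizes
    (a b γ : ℕ → ℝ)
    (ha : ∀ k, a k ∈ Set.Icc (0 : ℝ) 1) (hb : ∀ k, b k ∈ Set.Icc (0 : ℝ) 1)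
    (hγ : ∀ k, γ k ∈ Set.Ioo 0 (2 / L))
    (τ : ℝ) (hτ : 0 < τ)
    (hB : ∀ k, 1 ≤ k →
      (a k < γ k * L / 2 * b k ∧ τ < (1 + a k) - γ k * L / 2 * (1 + b k) ^ 2) ∨
      ((b k ≤ a k ∨ (γ k * L / 2 * b k ≤ a k ∧ a k < b k)) ∧
        τ < (1 - 3 * a k) - γ k * L / 2 * (1 - b k) ^ 2))
    -- their limits
    (a' b' γ' : ℝ)
    (ha' : a' ∈ Set.Icc (0 : ℝ) 1) (hb' : b' ∈ Set.Icc (0 : ℝ) 1) (hγ' : γ' ∈ Set.Ioo 0 (2 / L))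
    (hlima : Filter.Tendsto a Filter.atTop (nhds a'))
    (hlimb : Filter.Tendsto b Filter.atTop (nhds b'))
    (hlimγ : Filter.Tendsto γ Filter.atTop (nhds γ'))
    -- the bound on the smallest eigenvalue of `G_θ`
    (hC : a' < 1 → b' < 1 → ∀ θ ∈ Θ, ∀ η ∈ spectrum ℝ (InertialDiff.matG f γ' θ),
      (2 * (b' - a') - 1) / (1 + 2 * b') < η)
    -- the initialization
    (X₀ : InertialDiff.Eucl m → InertialDiff.State n) (hX₀ : ContDiffOn ℝ 1 X₀ Θ) :
    ∀ θ ∈ Θ,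
      -- `x⋆(θ)` is the unique minimizer, and the derivatives in the estimate exist
      (InertialDiff.IsMinimizer f θ (InertialDiff.xStar f θ) ∧
        ∀ x, InertialDiff.IsMinimizer f θ x → x = InertialDiff.xStar f θ) ∧
      DifferentiableAt ℝ (InertialDiff.XStar f) θ ∧
      (∀ k, DifferentiableAt ℝ (InertialDiff.iterate f a b γ X₀ k) θ) ∧
      -- the estimate, in the operator norm
      ∀ ε : ℝ, 0 < ε → ∃ K : ℕ, ∀ k ≥ K,
        ‖fderiv ℝ (InertialDiff.iterate f a b γ X₀ (k + 1)) θ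
            - fderiv ℝ (InertialDiff.XStar f) θ‖
          ≤ 2 * InertialDiff.specRadius (InertialDiff.matM f a' b' γ' θ)
              * ‖fderiv ℝ (InertialDiff.iterate f a b γ X₀ k) θ
                  - fderiv ℝ (InertialDiff.XStar f) θ‖
            + ε * (2 + ‖fderiv ℝ (InertialDiff.iterate f a b γ X₀ k) θ
                  - fderiv ℝ (InertialDiff.XStar f) θ‖) := by
  have hgrad : ∀ θ ∈ Θ, ∀ x, HasGradientAt (fun y => f y θ) (InertialDiff.gradX f x θ) x :=
    fun θ hθ x => InertialDiff.hasGradientAt_gradX hΘ hf hθ x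
  have hmin : ∀ θ ∈ Θ, InertialDiff.IsMinimizer f θ (InertialDiff.xStar f θ) := fun θ hθ =>
    InertialDiff.isMinimizer_xStar (InertialDiff.exists_isMinimizer
      (continuous_iff_continuousAt.2 fun x => (hgrad θ hθ x).differentiableAt.continuousAt)
      (hlev θ hθ))
  intro θ hθ
  obtain ⟨μ, hμ, hφ⟩ := hconv θ hθ
  have hLx : ∀ x y, ‖InertialDiff.gradX f x θ - InertialDiff.gradX f y θ‖ ≤ L * ‖x - y‖ :=
    fun x y => by simpa [Real.sqrt_sq] using hLip x y θ hθ θ hθ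
  have hmono := strong_monotone_gradient hφ (hgrad θ hθ)
  have hco := cocoercive_gradient hμ.le hL hφ (hgrad θ hθ) hLx
  have h0 : ∀ᶠ θ' in nhds θ, InertialDiff.gradX f (InertialDiff.xStar f θ') θ' = 0 :=
    Filter.mem_of_superset (hΘ.mem_nhds hθ) fun θ' hθ' => (hmin θ' hθ').gradX_eq_zero
  have hxdiff : DifferentiableAt ℝ (InertialDiff.xStar f) θ := by
    refine differentiableAt_of_zero_of_coercive (C := L / μ) hμ
      (InertialDiff.hasFDerivAt_gradX hΘ hf hθ _) h0 ?_
      (strong_monotone_fderiv (InertialDiff.hasFDerivAt_gradX_left hΘ hf hθ _) hmono)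
    filter_upwards [hΘ.mem_nhds hθ] with θ' hθ'
    exact InertialDiff.norm_xStar_sub_le hμ hmono
      (fun x => by simpa [Real.sqrt_sq] using hLip x x θ hθ θ' hθ')
      (hmin θ hθ).gradX_eq_zero (hmin θ' hθ').gradX_eq_zero
  have hsdiff := fun k => InertialDiff.differentiableAt_inertialSeq (a := a) (b := b) (γ := γ)
    hΘ hf hθ hX₀ k
  have hlim := InertialDiff.tendsto_fderiv_iterate_sub hxdiff hsdiff
    (InertialDiff.tendsto_fderiv_inertialSeq hΘ hf hθ hX₀ hL hμ hmono hco h0 hxdiff hb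
      (fun k => (hγ k).1) ha'.1 hγ'.1 hlima hlimb hlimγ
      (inertial_margin_limit hτ hL hb hγ hB hlima hlimb hlimγ))
  refine ⟨⟨hmin θ hθ, fun x hx => hx.unique hμ hφ (hmin θ hθ)⟩, InertialDiff.differentiableAt_XStar hxdiff,
    fun k => InertialDiff.differentiableAt_iterate (hsdiff k) (hsdiff (k + 1)), fun ε hε => ?_⟩
  -- The threshold `2 * ε` is the constant part of `ε * (2 + ‖·‖)`; the other terms on the right are
  -- nonnegative.
  have h1 := (hlim.norm.comp (Filter.tendsto_add_atTop_nat 1)).eventually_lt_const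
    (show ‖(0 : InertialDiff.Eucl m →L[ℝ] InertialDiff.State n)‖ < 2 * ε by simpa using hε)
  obtain ⟨K, hK⟩ := Filter.eventually_atTop.1 h1
  refine ⟨K, fun k hk => (hK k hk).le.trans ?_⟩
  have hρ : 0 ≤ InertialDiff.specRadius (InertialDiff.matM f a' b' γ' θ) := ENNReal.toReal_nonneg
  have h2 := norm_nonneg (fderiv ℝ (InertialDiff.iterate f a b γ X₀ k) θ
    - fderiv ℝ (InertialDiff.XStar f) θ)
  nlinarith [mul_nonneg hρ h2, mul_nonneg hε.le h2]
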